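/- **Conventions.** Let $\Lambda,\Omega$ be countably infinite sets and let $\mathcal F$ be a nonempty family of infinite subsets of $\Omega$ such that $F\setminus K\in\mathcal F$ for every $F\in\mathcal F$ and every finite $K\subseteq\Omega$. A function $\rho$ from $\mathcal F$ to the family of infinite subsets of $\Lambda$ is *partition regular* if - (M) $E\subseteq F$ implies $\rho(E)\subseteq\rho(F)$ for all $E,F\in\mathcal F$; - (R) whenever $F\in\mathcal F$ and $\rho(F)=A\cup B$, there is $E\in\mathcal F$ with $\rho(E)\subseteq A$ or $\rho(E)\subseteq B$; - (S) for every $E\in\mathcal F$ there is $F\in\mathcal F$ with $F\subseteq E$ such that for every $a\in\rho(F)$ there is a finite $K\subseteq\Omega$ with $a\notin\rho(F\setminus K)$. $\mathrm{FinBW}(\rho)$ is the class of all topological spaces $Y$ such that for every $f:\Lambda\to Y$ there are $F\in\mathcal F$ and $y\in Y$ such that for every neighbourhood $U$ of $y$ there is a finite $K\subseteq\Omega$ with $f[\rho(F\setminus K)]\subseteq U$. For partition regular $\rho_i$, defined on families $\mathcal F_i$ of subsets of $\Omega_i$ with values subsets of $\Lambda_i$ ($i=1,2$), $\rho_2\le_K\rho_1$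 means that there is $f:\Lambda_1\to\Lambda_2$ such that for every $F_1\in\mathcal F_1$ there is $F_2\in\mathcal F_2$ such that for every finite $K_1\subseteq\Omega_1$ there is a finite $K_2\subseteq\Omega_2$ with $\rho_2(F_2\setminus K_2)\subseteq f[\rho_1(F_1\setminus K_1)]$. **The function $\rho^{[0,1]}$.** Let $\mathrm{conv}$ be the family of all subsets of $\mathbb Q\cap[0,1]$ that can be covered by the ranges of finitely many sequences in $\mathbb Q\cap[0,1]$ which converge in $[0,1]$. Let $X$ be the set of all injections $x:\omega\times\omega\to\mathbb Q\cap[0,1]$ such that $x[(\omega\setminus[0,n])\times\omega]\notin\mathrm{conv}$ for all $n\in\omega$, and every $p\in[0,1]$ has a neighbourhood $U$ with $x[(\omega\setminus[0,n])\times\omega]\not\subseteq U$ for all $n\in\omega$. Let $(A_\alpha)_{\alpha\in I}$ be any family of infinite subsets of $\omega$ with $A_\alpha\cap A_\beta$ finite for $\alpha\ne\beta$, indexed by a set $I$ (for instance the cardinal $\mathfrak c$), and let $X=\{x_\alpha:\alpha\in I\}$ be any enumeration of $X$. Define $\rho^{[0,1]}$ on $\{A_\alpha\setminus K:\alpha\in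 I,\ K\subseteq\omega\text{ finite}\}$ by $$\rho^{[0,1]}(A_\alpha\setminus K)=x_\alpha\big[(\omega\setminus[0,\max(A_\alpha\cap K)])\times\omega\big],$$ where $[0,\max\emptyset]=\emptyset$. **Theorem.** The function $\rho^{[0,1]}$ is partition regular, and for every partition regular function $\rho$ the following conditions are equivalent. 1. For every metric space $Y$: $Y\in\mathrm{FinBW}(\rho)$ if and only if $Y$ is compact. 2. $[0,1]\in\mathrm{FinBW}(\rho)$. 3. $\rho^{[0,1]}\not\le_K\rho$. -/

import Mathlib

/-!
For `F` in the domain of `ρ`, the sets `ρ(F ∖ K)` with `K` finite generate a tail filter on `Λ`.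
In these terms `ρ`-convergence along `F` is convergence along the tail filter, and `ρ₂ ≤_K ρ₁` says
that some `f` pushes every tail filter of `ρ₁` above a tail filter of `ρ₂`. Hence membership in
`FinBW` passes from `ρ₁` to `ρ₂`.

A set is in `conv` exactly when it has finitely many limit points in `[0,1]`. Call a filter on
`ℚ ∩ [0,1]` spread if all its members have infinitely many limit points and it does not converge in
`[0,1]`. The tail filters of `ρ^{[0,1]}` are the images of the filter of row tails of `ω × ω` under
the injections which make these images spread, so `[0,1] ∉ FinBW(ρ^{[0,1]})`. Moreover they are
coinitial: given a countably generated spread filter containing the cofinite sets, an injection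
whose `n`-th row enumerates part of the `n`-th basis set, without losing a limit point, maps the
filter of row tails to a spread filter below the given one.

If `[0,1] ∉ FinBW(ρ)`, a function without `ρ`-convergent restrictions can be perturbed to an
injection `g` into `ℚ ∩ [0,1]`. By condition (R) a restriction with finitely many limit points would
yield a `ρ`-convergent one, so `g` maps the tail filters of `ρ` to spread filters, and coinitiality
gives `ρ^{[0,1]} ≤_K ρ`. That `[0,1] ∈ FinBW(ρ)` implies the same for every compact metric space
holds because such a space is a continuous image of the Cantor set, which is closed in `[0,1]`.
-/

open Filter Topology Set

/-- A map `ρ` defined on a family `dom` of subsets of `Ω`, with subsets of `Λ` as values.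
The map is stored as a total function; only its values on members of `dom` matter. -/
structure FamilyMap (Ω : Type*) (Λ : Type*) where
  /-- the family on which the map is defined -/
  dom : Set (Set Ω)
  /-- the map -/
  map : Set Ω → Set Λ

namespace FamilyMap

variable {Ω Λ : Type*}

/-- Partition regular functions `ρ : 𝓕 → [Λ]^ω` with `𝓕 ⊆ [Ω]^ω`. -/
structure IsPartitionRegular (ρ : FamilyMap Ω Λ) : Prop where
  countable_source : Countable Ω
  infinite_source : Infinite Ω
  countable_target : Countable Λ
  infinite_target : Infinite Λ
  dom_nonempty : ρ.dom.Nonempty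
  infinite_of_mem : ∀ F ∈ ρ.dom, F.Infinite
  diff_mem : ∀ F ∈ ρ.dom, ∀ K : Set Ω, K.Finite → F \ K ∈ ρ.dom
  map_infinite : ∀ F ∈ ρ.dom, (ρ.map F).Infinite
  /-- condition (M) -/
  mono : ∀ E ∈ ρ.dom, ∀ F ∈ ρ.dom, E ⊆ F → ρ.map E ⊆ ρ.map F
  /-- condition (R) -/
  regular : ∀ F ∈ ρ.dom, ∀ A B : Set Λ, ρ.map F = A ∪ B →
    ∃ E ∈ ρ.dom, ρ.map E ⊆ A ∨ ρ.map E ⊆ B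
  /-- condition (S) -/
  sparse : ∀ E ∈ ρ.dom, ∃ F ∈ ρ.dom, F ⊆ E ∧
    ∀ a ∈ ρ.map F, ∃ K : Set Ω, K.Finite ∧ a ∉ ρ.map (F \ K)

/-- `f ↾ ρ(F)` is `ρ`-convergent to `y`. -/
def ConvergesTo (ρ : FamilyMap Ω Λ) {Y : Type*} [TopologicalSpace Y]
    (f : Λ → Y) (F : Set Ω) (y : Y) : Prop :=
  ∀ U ∈ 𝓝 y, ∃ K : Set Ω, K.Finite ∧ f '' ρ.map (F \ K) ⊆ U

/-- The space `Y` belongs to `FinBW(ρ)`. -/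
def FinBW (ρ : FamilyMap Ω Λ) (Y : Type*) [TopologicalSpace Y] : Prop :=
  ∀ f : Λ → Y, ∃ F ∈ ρ.dom, ∃ y : Y, ρ.ConvergesTo f F y

/-- The Katětov order: `KatetovLE ρ₂ ρ₁` means `ρ₂ ≤_K ρ₁`. -/
def KatetovLE {Ω₂ Λ₂ Ω₁ Λ₁ : Type*} (ρ₂ : FamilyMap Ω₂ Λ₂) (ρ₁ : FamilyMap Ω₁ Λ₁) : Prop :=
  ∃ f : Λ₁ → Λ₂, ∀ F₁ ∈ ρ₁.dom, ∃ F₂ ∈ ρ₂.dom,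
    ∀ K₁ : Set Ω₁, K₁.Finite → ∃ K₂ : Set Ω₂, K₂.Finite ∧
      ρ₂.map (F₂ \ K₂) ⊆ f '' ρ₁.map (F₁ \ K₁)

end FamilyMap

/-- The set `ℚ ∩ [0,1]`, as a subset of the unit interval. -/
def ratUnit : Set unitInterval := {t | ∃ q : ℚ, (q : ℝ) = (t : ℝ)}

/-- Membership in the ideal `conv` on `ℚ ∩ [0,1]`: the set is covered by the ranges of finitely
many sequences in `ℚ ∩ [0,1]` that converge in `[0,1]`. -/
def MemConv (B : Set ratUnit) : Prop :=
  ∃ (m : ℕ) (s : Fin m → ℕ → ratUnit),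
    (∀ i, ∃ p : unitInterval, Tendsto (fun k => (s i k : unitInterval)) atTop (𝓝 p)) ∧
    B ⊆ ⋃ i, range (s i)

/-- The family of all injections `x : ω × ω → ℚ ∩ [0,1]` whose sets
`x[(ω ∖ [0,n]) × ω]`, `n ∈ ω`, do not belong to `conv` and such that every point of `[0,1]` has a
neighbourhood that contains none of these sets. -/
def spreadInjections : Set (ℕ × ℕ → ratUnit) :=
  {x | (∀ p : unitInterval, ∃ U ∈ 𝓝 p, ∀ n : ℕ,
          ¬ (fun z => (x z : unitInterval)) '' {z : ℕ × ℕ | n < z.1} ⊆ U) ∧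
       Function.Injective x ∧
       ∀ n : ℕ, ¬ MemConv (x '' {z : ℕ × ℕ | n < z.1})}

/-- `(A α)` is an (injectively indexed) almost disjoint family of infinite subsets of `ω`. -/
def IsAlmostDisjointFamily {ι : Type*} (A : ι → Set ℕ) : Prop :=
  (∀ α, (A α).Infinite) ∧ ∀ α β, α ≠ β → (A α ∩ A β).Finite

/-- The function `ρ^{[0,1]}` determined by the almost disjoint family `(A α)` and the enumeration
`(x α)`: it is defined on the sets `A α ∖ K` with `K` finite, and sends `A α ∖ K` to
`x α [(ω ∖ [0, max (A α ∩ K)]) × ω]`, which is all of `x α [ω × ω]` if `A α ∩ K = ∅`. -/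
def rhoUnit {ι : Type*} (A : ι → Set ℕ) (x : ι → ℕ × ℕ → ratUnit) : FamilyMap ℕ ratUnit where
  dom := {E | ∃ (α : ι) (K : Set ℕ), K.Finite ∧ E = A α \ K}
  map E := {q | ∃ (α : ι) (K : Set ℕ), K.Finite ∧ E = A α \ K ∧
    q ∈ x α '' {z : ℕ × ℕ | ∀ m ∈ A α ∩ K, m < z.1}}

/-- For an almost disjoint family, the value at `A α ∖ K` does not depend on how that set is
represented. -/
theorem rhoUnit_map_diff {ι : Type*} {A : ι → Set ℕ} (hA : IsAlmostDisjointFamily A)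
    (x : ι → ℕ × ℕ → ratUnit) (α : ι) {K : Set ℕ} (hK : K.Finite) :
    (rhoUnit A x).map (A α \ K) = x α '' {z : ℕ × ℕ | ∀ m ∈ A α ∩ K, m < z.1} := by
  ext q
  constructor
  · rintro ⟨β, L, hL, hE, hq⟩
    have hαβ : α = β := by
      by_contra hne
      refine ((hA.1 α).sdiff hK) ((hA.2 α β hne).subset fun m hm => ⟨hm.1, ?_⟩)
      rw [hE] at hm
      exact hm.1
    subst hαβ
    have hKL : A α ∩ K = A α ∩ L := by
      rw [← sdiff_sdiff_right_self, ← sdiff_sdiff_right_self]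
      rw [hE]
    rwa [hKL]
  · intro hq
    exact ⟨α, K, hK, rfl, hq⟩

theorem exists_injective_mem_of_infinite {ι Λ : Type*} [Countable ι] {T : ι → Set Λ}
    (hT : ∀ i, (T i).Infinite) : ∃ f : ι → Λ, Function.Injective f ∧ ∀ i, f i ∈ T i := by
  classical
  obtain ⟨e, he⟩ := exists_injective_nat ι
  choose t htT ht using fun i => (hT i).exists_subset_card_eq (e i + 1)
  -- Hall's condition: the index of `s` with the largest code `e i` alone contributes enough points.
  have hall (s : Finset ι) : s.card ≤ (s.biUnion t).card := by
    rcases s.eq_empty_or_nonempty with rfl | hs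
    · simp
    obtain ⟨i, hi, hmax⟩ := s.exists_max_image e hs
    calc s.card ≤ (Finset.range (e i + 1)).card :=
          Finset.card_le_card_of_injOn e
            (fun j hj => Finset.mem_coe.2 (Finset.mem_range_succ_iff.2 (hmax j hj))) he.injOn
      _ = (t i).card := by rw [Finset.card_range, ht]
      _ ≤ (s.biUnion t).card := Finset.card_le_card (Finset.subset_biUnion_of_mem t hi)
  obtain ⟨f, hf, hft⟩ := (Finset.all_card_le_biUnion_card_iff_exists_injective t).1 hall
  exact ⟨f, hf, fun i => htT i (hft i)⟩

section LimitPoints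

variable {Λ Λ' X : Type*} [TopologicalSpace X] {f : Λ → X} {S T : Set Λ} {p : X}

/-- The limit points of `f` along `S`: the points `p` such that every neighbourhood of `p` contains
`f a` for infinitely many indices `a ∈ S`. Counting indices rather than values keeps the notion
compatible with composition; the ideal `conv` is characterized by having finitely many of them. -/
def limitPoints (f : Λ → X) (S : Set Λ) : Set X :=
  {p | MapClusterPt p (cofinite ⊓ 𝓟 S) f}

theorem mem_limitPoints_iff : p ∈ limitPoints f S ↔ ∀ U ∈ 𝓝 p, (S ∩ f ⁻¹' U).Infinite := by
  refine mapClusterPt_iff_frequently.trans <| forall₂_congr fun U _ => ?_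
  rw [frequently_inf_principal, frequently_cofinite_iff_infinite]
  rfl

theorem limitPoints_mono (h : S ⊆ T) : limitPoints f S ⊆ limitPoints f T :=
  fun _ hp => MapClusterPt.mono hp (inf_le_inf_left _ (principal_mono.2 h))

theorem limitPoints_image {g : Λ' → Λ} (hg : Function.Injective g) (S : Set Λ') :
    limitPoints f (g '' S) = limitPoints (f ∘ g) S := by
  ext p
  simp only [mem_limitPoints_iff, ← image_inter_preimage, infinite_image_iff hg.injOn,
    preimage_comp]

theorem limitPoints_iUnion {ι : Type*} [Finite ι] (S : ι → Set Λ) :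
    limitPoints f (⋃ i, S i) = ⋃ i, limitPoints f (S i) := by
  refine Subset.antisymm (fun p hp => ?_)
    (iUnion_subset fun i => limitPoints_mono (subset_iUnion S i))
  by_contra hcon
  simp only [mem_iUnion, mem_limitPoints_iff, not_exists, not_forall, not_infinite] at hcon
  choose U hU hfin using hcon
  refine mem_limitPoints_iff.1 hp (⋂ i, U i) (iInter_mem.2 hU)
    ((finite_iUnion hfin).subset fun a ha => ?_)
  obtain ⟨i, hi⟩ := mem_iUnion.1 ha.1
  exact mem_iUnion.2 ⟨i, hi, mem_iInter.1 ha.2 i⟩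

theorem limitPoints_eq_empty_of_finite (hS : S.Finite) : limitPoints f S = ∅ :=
  eq_empty_of_forall_notMem fun _ hp =>
    mem_limitPoints_iff.1 hp univ univ_mem (hS.subset inter_subset_left)

theorem limitPoints_nonempty [CompactSpace X] (hS : S.Infinite) : (limitPoints f S).Nonempty :=
  have := hS.cofinite_inf_principal_neBot
  exists_clusterPt_of_compactSpace _

theorem limitPoints_univ_of_denseRange [T1Space X] [∀ q : X, (𝓝[≠] q).NeBot]
    (hf : DenseRange f) : limitPoints f univ = univ := by
  refine eq_univ_of_forall fun p => mem_limitPoints_iff.2 fun U hU hfin => ?_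
  obtain ⟨V, hVU, hV, hpV⟩ := mem_nhds_iff.1 hU
  have hVf : (V ∩ range f).Finite := by
    rw [← image_preimage_eq_inter_range]
    exact (hfin.subset fun a ha => ⟨mem_univ a, hVU ha⟩).image f
  have hVfin : V.Finite := hVf.subset <|
    hVf.isClosed.closure_eq ▸ hf.open_subset_closure_inter hV
  exact infinite_of_mem_nhds p (hV.mem_nhds hpV) hVfin

theorem limitPoints_subset_singleton_of_tendsto [T2Space X]
    (hp : Tendsto f (cofinite ⊓ 𝓟 S) (𝓝 p)) : limitPoints f S ⊆ {p} :=
  fun _ hq => eq_of_nhds_neBot (ClusterPt.mono hq hp)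

theorem cofinite_isCountablyGenerated [Countable Λ] :
    (cofinite : Filter Λ).IsCountablyGenerated :=
  HasCountableBasis.isCountablyGenerated ⟨hasBasis_cofinite, Countable.ofPred_finite⟩

theorem cofinite_inf_principal_range_le_map {ι : Type*} (u : ι → Λ) :
    cofinite ⊓ 𝓟 (range u) ≤ map u cofinite := by
  intro s hs
  rw [mem_inf_principal', mem_cofinite, compl_union, compl_compl]
  refine (Set.Finite.image u (mem_cofinite.1 hs)).subset ?_
  rintro _ ⟨⟨i, rfl⟩, hi⟩
  exact ⟨i, hi, rfl⟩

/-- Only finitely many indices escape because a limit point of the escaping part would lie in one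
of the separating neighbourhoods, which that part avoids. -/
theorem exists_tendsto_cover_of_finite_limitPoints [CompactSpace X] [T2Space X]
    (h : (limitPoints f S).Finite) : ∃ T : X → Set Λ,
      (∀ p ∈ limitPoints f S, Tendsto f (cofinite ⊓ 𝓟 (T p)) (𝓝 p)) ∧
      (S \ ⋃ p ∈ limitPoints f S, T p).Finite := by
  obtain ⟨U, hU, hdisj⟩ := h.t2_separation
  have hUnhds (p : X) : U p ∈ 𝓝 p := (hU p).2.mem_nhds (hU p).1
  refine ⟨fun p => S ∩ f ⁻¹' U p, fun p hp => ?_, ?_⟩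
  · refine tendsto_nhds_of_unique_mapClusterPt fun q (hq : q ∈ limitPoints f _) => ?_
    obtain ⟨a, ⟨-, hap⟩, haq⟩ := (mem_limitPoints_iff.1 hq _ (hUnhds q)).nonempty
    exact hdisj.elim (limitPoints_mono inter_subset_left hq) hp
      (not_disjoint_iff.2 ⟨f a, haq, hap⟩)
  · by_contra hinf
    obtain ⟨q, hq⟩ := limitPoints_nonempty (f := f) hinf
    obtain ⟨a, ⟨haS, ha⟩, haq⟩ := (mem_limitPoints_iff.1 hq _ (hUnhds q)).nonempty
    exact ha (mem_iUnion₂.2 ⟨q, limitPoints_mono sdiff_subset hq, haS, haq⟩)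

theorem exists_injective_tendsto_dist_zero {D Y : Type*} [MetricSpace Y]
    [∀ q : Y, (𝓝[≠] q).NeBot] [Countable Λ] {u : D → Y} (hu : DenseRange u) (f : Λ → Y) :
    ∃ g : Λ → D, Function.Injective g ∧
      Tendsto (fun a => dist (f a) (u (g a))) cofinite (𝓝 0) := by
  obtain ⟨e, he⟩ := exists_injective_nat Λ
  have hinf (a : Λ) : (u ⁻¹' Metric.ball (f a) (1 / (e a + 1))).Infinite := by
    have hfa : f a ∈ limitPoints u univ := limitPoints_univ_of_denseRange hu ▸ mem_univ _
    simpa only [univ_inter] using mem_limitPoints_iff.1 hfa _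
      (Metric.ball_mem_nhds _ Nat.one_div_pos_of_nat)
  obtain ⟨g, hg, hgu⟩ := exists_injective_mem_of_infinite hinf
  refine ⟨g, hg, squeeze_zero (fun _ => dist_nonneg) (fun a => (Metric.mem_ball'.1 (hgu a)).le) ?_⟩
  have he_tendsto : Tendsto e cofinite atTop := Nat.cofinite_eq_atTop ▸ he.tendsto_cofinite
  exact tendsto_one_div_add_atTop_nhds_zero_nat.comp he_tendsto

end LimitPoints

section Spread

variable {Λ X : Type*} [TopologicalSpace X] {f : Λ → X} {l : Filter Λ}

/-- A map `f` is spread along a filter `l` if it has infinitely many limit points along every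
member of `l` and does not converge along `l`. It is the filter form of the two conditions that
`spreadInjections` imposes besides injectivity. -/
structure IsSpread (f : Λ → X) (l : Filter Λ) : Prop where
  infinite_limitPoints : ∀ s ∈ l, (limitPoints f s).Infinite
  not_tendsto : ∀ p, ¬ Tendsto f l (𝓝 p)

/-- The filter on `ω × ω` generated by the sets `(ω ∖ [0,n]) × ω`, along which `ρ^{[0,1]}` samples
the injections `x α`. -/
def rowTails : Filter (ℕ × ℕ) := comap Prod.fst atTop

theorem hasBasis_rowTails : rowTails.HasBasis (fun _ => True) fun n : ℕ => {z | n < z.1} :=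
  atTop_basis_Ioi.comap Prod.fst

theorem rowTails_le_cofinite : rowTails ≤ cofinite :=
  le_cofinite_iff_compl_singleton_mem.2 fun z => hasBasis_rowTails.mem_iff.2
    ⟨z.1, trivial, fun w (hw : z.1 < w.1) (hwz : w = z) => hw.ne (congrArg Prod.fst hwz.symm)⟩

theorem IsSpread.map {Λ' : Type*} {g : Λ' → Λ} {l : Filter Λ'} (hg : Function.Injective g)
    (h : IsSpread (f ∘ g) l) : IsSpread f (map g l) where
  infinite_limitPoints s hs := (h.infinite_limitPoints _ hs).mono <| by
    rw [← limitPoints_image hg]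
    exact limitPoints_mono (image_preimage_subset g s)
  not_tendsto p hp := h.not_tendsto p (tendsto_map'_iff.1 hp)

theorem isSpread_cofinite_inf_principal [T2Space X] {D : Set Λ}
    (hD : (limitPoints f D).Infinite) : IsSpread f (cofinite ⊓ 𝓟 D) where
  infinite_limitPoints _ hs := hD.mono fun _ hp =>
    MapClusterPt.mono hp (le_inf inf_le_left (le_principal_iff.2 hs))
  not_tendsto p hp := hD ((finite_singleton p).subset (limitPoints_subset_singleton_of_tendsto hp))

/-- The sets `T j` are the infinite sets `S ∩ f ⁻¹' b` with `b` in a countable basis, each listed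
infinitely often, together with `S` itself. -/
theorem exists_seq_infinite_subsets [SecondCountableTopology X] (f : Λ → X) {S : Set Λ}
    (hS : S.Infinite) : ∃ T : ℕ → Set Λ, (∀ j, (T j).Infinite ∧ T j ⊆ S) ∧
      ∀ p ∈ limitPoints f S, ∀ U ∈ 𝓝 p, {j | T j ⊆ f ⁻¹' U}.Infinite := by
  let 𝓑 : Set (Set X) :=
    {b | b ∈ insert univ (TopologicalSpace.countableBasis X) ∧ (S ∩ f ⁻¹' b).Infinite}
  have : Countable 𝓑 :=
    (((TopologicalSpace.countable_countableBasis X).insert univ).mono fun _ hb => hb.1).to_subtype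
  have : Nonempty 𝓑 := ⟨univ, mem_insert _ _, by simpa using hS⟩
  obtain ⟨e, he⟩ := exists_surjective_nat (𝓑 × ℕ)
  refine ⟨fun j => S ∩ f ⁻¹' (e j).1, fun j => ⟨(e j).1.2.2, inter_subset_left⟩,
    fun p hp U hU => ?_⟩
  obtain ⟨b, hb, hpb, hbU⟩ := (TopologicalSpace.isBasis_countableBasis X).mem_nhds_iff.1 hU
  have hb𝓑 : b ∈ 𝓑 := ⟨mem_insert_of_mem _ hb, mem_limitPoints_iff.1 hp b
    (((TopologicalSpace.isBasis_countableBasis X).isOpen hb).mem_nhds hpb)⟩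
  choose j hj using fun n => he (⟨b, hb𝓑⟩, n)
  have hj_inj : Function.Injective j := fun m n hmn => by
    simpa only [hj, Prod.mk.injEq, true_and] using congrArg e hmn
  refine (infinite_range_of_injective hj_inj).mono ?_
  rintro _ ⟨n, rfl⟩ a ⟨-, ha⟩
  rw [hj] at ha
  exact hbU ha

theorem exists_injective_limitPoints_subset [SecondCountableTopology X] {ι : Type*} [Countable ι]
    (f : Λ → X) {C : ι → Set Λ} (hC : ∀ i, (C i).Infinite) :
    ∃ x : ι × ℕ → Λ, Function.Injective x ∧ (∀ z, x z ∈ C z.1) ∧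
      ∀ i, limitPoints f (C i) ⊆ limitPoints (f ∘ x) (Prod.fst ⁻¹' {i}) := by
  choose T hT hTU using fun i => exists_seq_infinite_subsets f (hC i)
  obtain ⟨x, hx, hxT⟩ := exists_injective_mem_of_infinite
    (T := fun z : ι × ℕ => T z.1 z.2) fun z => (hT z.1 z.2).1
  refine ⟨x, hx, fun z => (hT z.1 z.2).2 (hxT z), fun i p hp => ?_⟩
  refine mem_limitPoints_iff.2 fun U hU => ?_
  refine ((hTU i p hp U hU).image (Prod.mk_right_injective i).injOn).mono ?_
  rintro _ ⟨j, hj, rfl⟩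
  exact ⟨rfl, hj (hxT (i, j))⟩

theorem mapClusterPt_rowTails {g : ℕ × ℕ → X} {p : X}
    (hp : ∀ n, p ∈ limitPoints g (Prod.fst ⁻¹' {n})) : MapClusterPt p rowTails g := by
  refine mapClusterPt_iff_frequently.2 fun U hU => frequently_comap.2 <|
    Frequently.of_forall fun n => ?_
  exact (mem_limitPoints_iff.1 (hp n) U hU).nonempty

/-- Each row of `x` runs through one set of an antitone basis of `l` and has all its limit points,
so the cluster points along `l` stay cluster points along the row tails. By compactness, convergence
along the row tails would then force convergence along `l`. -/
theorem IsSpread.exists_injective_map_rowTails_le [CompactSpace X] [T2Space X]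
    [SecondCountableTopology X] [l.IsCountablyGenerated] (hl : l ≤ cofinite) (h : IsSpread f l) :
    ∃ x : ℕ × ℕ → Λ, Function.Injective x ∧ Filter.map x rowTails ≤ l ∧
      IsSpread (f ∘ x) rowTails := by
  obtain ⟨C, hC⟩ := l.exists_antitone_basis
  have hC_inf (n : ℕ) : (C n).Infinite := fun hfin =>
    h.infinite_limitPoints _ (hC.mem n) (by simp [limitPoints_eq_empty_of_finite hfin])
  obtain ⟨x, hx, hxC, hlim⟩ := exists_injective_limitPoints_subset f hC_inf
  refine ⟨x, hx, ?_, fun s hs => ?_, fun p hp => h.not_tendsto p ?_⟩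
  · refine hC.1.ge_iff.2 fun n _ =>
      mem_map.2 (mem_of_superset (hasBasis_rowTails.mem_of_mem (i := n) trivial) ?_)
    exact fun z (hz : n < z.1) => hC.2 hz.le (hxC z)
  · obtain ⟨n, -, hn⟩ := hasBasis_rowTails.mem_iff.1 hs
    have hrow : Prod.fst ⁻¹' {n + 1} ⊆ s := fun z (hz : z.1 = n + 1) =>
      hn (n.lt_succ_self.trans_eq hz.symm)
    exact (h.infinite_limitPoints _ (hC.mem (n + 1))).mono
      ((hlim (n + 1)).trans (limitPoints_mono hrow))
  · refine tendsto_nhds_of_unique_mapClusterPt fun q hq => ?_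
    have hq_row : MapClusterPt q rowTails (f ∘ x) := mapClusterPt_rowTails fun n =>
      hlim n (hq.mono (le_inf hl (le_principal_iff.2 (hC.mem n))))
    exact eq_of_nhds_neBot (ClusterPt.mono hq_row hp)

end Spread

section ConvIdeal

variable {S T : Set ratUnit}

theorem countable_ratUnit : Countable ratUnit :=
  ((countable_range ((↑) : ℚ → ℝ)).preimage Subtype.val_injective).to_subtype

theorem dense_ratUnit : Dense ratUnit := by
  refine dense_of_exists_between fun a b hab => ?_
  obtain ⟨q, haq, hqb⟩ := exists_rat_btwn (Subtype.coe_lt_coe.2 hab)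
  exact ⟨⟨q, a.2.1.trans haq.le, hqb.le.trans b.2.2⟩, ⟨q, rfl⟩, haq, hqb⟩

theorem MemConv.mono (hT : MemConv T) (h : S ⊆ T) : MemConv S :=
  let ⟨m, s, hs, hTs⟩ := hT
  ⟨m, s, hs, h.trans hTs⟩

theorem memConv_of_subset_iUnion_range {ι : Type*} [Finite ι] {s : ι → ℕ → ratUnit}
    (hs : ∀ i, ∃ p : unitInterval, Tendsto (fun k => (s i k : unitInterval)) atTop (𝓝 p))
    (hS : S ⊆ ⋃ i, range (s i)) : MemConv S := by
  obtain ⟨n, ⟨e⟩⟩ := Finite.exists_equiv_fin ι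
  refine ⟨n, s ∘ e.symm, fun i => hs _, hS.trans_eq ?_⟩
  exact (e.symm.surjective.iUnion_comp fun i => range (s i)).symm

theorem memConv_of_finite (hS : S.Finite) : MemConv S := by
  have := hS.to_subtype
  exact memConv_of_subset_iUnion_range (s := fun (q : S) _ => (q : ratUnit))
    (fun _ => ⟨_, tendsto_const_nhds⟩) fun q hq => mem_iUnion.2 ⟨⟨q, hq⟩, 0, rfl⟩

theorem MemConv.iUnion {ι : Type*} [Finite ι] {S : ι → Set ratUnit} (h : ∀ i, MemConv (S i)) :
    MemConv (⋃ i, S i) := by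
  choose m s hs hS using h
  refine memConv_of_subset_iUnion_range (s := fun j : Σ i, Fin (m i) => s j.1 j.2)
    (fun j => hs j.1 j.2) ?_
  rw [iUnion_sigma]
  exact iUnion_mono hS

theorem MemConv.union (hS : MemConv S) (hT : MemConv T) : MemConv (S ∪ T) := by
  rw [union_eq_iUnion]
  exact MemConv.iUnion (Bool.rec hT hS)

theorem memConv_of_tendsto {p : unitInterval}
    (hp : Tendsto ((↑) : ratUnit → unitInterval) (cofinite ⊓ 𝓟 S) (𝓝 p)) : MemConv S := by
  rcases S.finite_or_infinite with hfin | hinf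
  · exact memConv_of_finite hfin
  have := hinf.to_subtype
  have := countable_ratUnit
  obtain ⟨e⟩ := nonempty_equiv_of_countable (α := ℕ) (β := S)
  have he : Tendsto (fun k => (e k : ratUnit)) atTop (cofinite ⊓ 𝓟 S) := by
    rw [← Nat.cofinite_eq_atTop]
    exact tendsto_inf.2 ⟨(Subtype.val_injective.comp e.injective).tendsto_cofinite,
      tendsto_principal.2 (.of_forall fun k => (e k).2)⟩
  refine memConv_of_subset_iUnion_range (s := fun (_ : Unit) k => (e k : ratUnit))
    (fun _ => ⟨p, hp.comp he⟩) fun q hq => mem_iUnion.2 ⟨(), e.symm ⟨q, hq⟩, ?_⟩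
  simp

theorem memConv_iff : MemConv S ↔ (limitPoints ((↑) : ratUnit → unitInterval) S).Finite := by
  refine ⟨fun ⟨m, s, hs, hS⟩ => ?_, fun h => ?_⟩
  · choose p hp using hs
    refine (finite_range p).subset ((limitPoints_mono hS).trans ?_)
    rw [limitPoints_iUnion]
    refine iUnion_subset fun i => (limitPoints_subset_singleton_of_tendsto ?_).trans
      (singleton_subset_iff.2 (mem_range_self i))
    refine (tendsto_map'_iff.2 (hp i)).mono_left ?_
    rw [← Nat.cofinite_eq_atTop]
    exact cofinite_inf_principal_range_le_map (s i)
  · obtain ⟨T, hT, hrest⟩ := exists_tendsto_cover_of_finite_limitPoints h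
    have := h.to_subtype
    have hcover : MemConv (⋃ p ∈ limitPoints ((↑) : ratUnit → unitInterval) S, T p) := by
      rw [biUnion_eq_iUnion]
      exact MemConv.iUnion fun p => memConv_of_tendsto (hT p p.2)
    exact (hcover.union (memConv_of_finite hrest)).mono (sdiff_subset_iff.1 Subset.rfl)

theorem not_memConv_univ : ¬ MemConv univ := by
  rw [memConv_iff, limitPoints_univ_of_denseRange dense_ratUnit.denseRange_val]
  exact infinite_of_mem_nhds (0 : unitInterval) univ_mem

theorem mem_spreadInjections_iff {x : ℕ × ℕ → ratUnit} : x ∈ spreadInjections ↔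
    Function.Injective x ∧ IsSpread (fun z => (x z : unitInterval)) rowTails := by
  have hlim (hx : Function.Injective x) (n : ℕ) : ¬ MemConv (x '' {z | n < z.1}) ↔
      (limitPoints (fun z => (x z : unitInterval)) {z | n < z.1}).Infinite := by
    rw [memConv_iff, limitPoints_image hx]
    rfl
  have htendsto (p : unitInterval) : ¬ Tendsto (fun z => (x z : unitInterval)) rowTails (𝓝 p) ↔
      ∃ U ∈ 𝓝 p, ∀ n : ℕ, ¬ (fun z => (x z : unitInterval)) '' {z : ℕ × ℕ | n < z.1} ⊆ U := by
    simp only [hasBasis_rowTails.tendsto_left_iff, true_and, mapsTo_iff_image_subset, not_forall,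
      not_exists, exists_prop]
  constructor
  · rintro ⟨hsep, hx, hconv⟩
    refine ⟨hx, fun s hs => ?_, fun p => (htendsto p).2 (hsep p)⟩
    obtain ⟨n, -, hn⟩ := hasBasis_rowTails.mem_iff.1 hs
    exact ((hlim hx n).1 (hconv n)).mono (limitPoints_mono hn)
  · rintro ⟨hx, hspread⟩
    exact ⟨fun p => (htendsto p).1 (hspread.not_tendsto p), hx, fun n => (hlim hx n).2 <|
      hspread.infinite_limitPoints _ (hasBasis_rowTails.mem_of_mem trivial)⟩

end ConvIdeal

namespace FamilyMap

variable {Ω Λ : Type*} {ρ : FamilyMap Ω Λ} {E F : Set Ω} {X Y : Type*} [TopologicalSpace X]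
  [TopologicalSpace Y]

section Tails

/-- The filter on `Λ` generated by the sets `ρ(F ∖ K)` with `K` finite. It turns
`ρ`-convergence along `F` and the Katětov order into statements about filters. -/
def tails (ρ : FamilyMap Ω Λ) (F : Set Ω) : Filter Λ :=
  ⨅ K ∈ {K : Set Ω | K.Finite}, 𝓟 (ρ.map (F \ K))

theorem hasBasis_tails (hdiff : ∀ K : Set Ω, K.Finite → F \ K ∈ ρ.dom)
    (hmono : MonotoneOn ρ.map ρ.dom) :
    (ρ.tails F).HasBasis Set.Finite fun K => ρ.map (F \ K) := by
  refine hasBasis_biInf_principal (fun K hK L hL => ?_) ⟨∅, finite_empty⟩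
  have hKL : (K ∪ L).Finite := Finite.union hK hL
  exact ⟨K ∪ L, hKL,
    hmono (hdiff _ hKL) (hdiff _ hK) (sdiff_subset_sdiff_right subset_union_left),
    hmono (hdiff _ hKL) (hdiff _ hL) (sdiff_subset_sdiff_right subset_union_right)⟩

namespace IsPartitionRegular

variable (h : ρ.IsPartitionRegular)
include h

theorem hasBasis_tails (hF : F ∈ ρ.dom) :
    (ρ.tails F).HasBasis Set.Finite fun K => ρ.map (F \ K) :=
  FamilyMap.hasBasis_tails (h.diff_mem F hF) fun E hE F hF => h.mono E hE F hF

theorem convergesTo_iff_tendsto {f : Λ → X} {y : X} (hF : F ∈ ρ.dom) :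
    ρ.ConvergesTo f F y ↔ Tendsto f (ρ.tails F) (𝓝 y) := by
  simp only [ConvergesTo, (h.hasBasis_tails hF).tendsto_left_iff, mapsTo_iff_image_subset]

theorem map_mem_tails (hF : F ∈ ρ.dom) : ρ.map F ∈ ρ.tails F := by
  simpa only [sdiff_empty] using (h.hasBasis_tails hF).mem_of_mem finite_empty

theorem tails_neBot (hF : F ∈ ρ.dom) : (ρ.tails F).NeBot :=
  (h.hasBasis_tails hF).neBot_iff.2 fun hK => (h.map_infinite _ (h.diff_mem F hF _ hK)).nonempty

theorem tails_isCountablyGenerated (hF : F ∈ ρ.dom) : (ρ.tails F).IsCountablyGenerated :=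
  have := h.countable_source
  HasCountableBasis.isCountablyGenerated ⟨h.hasBasis_tails hF, Countable.ofPred_finite⟩

theorem tails_mono (hE : E ∈ ρ.dom) (hF : F ∈ ρ.dom) (hEF : E ⊆ F) : ρ.tails E ≤ ρ.tails F :=
  (h.hasBasis_tails hE).le_basis_iff (h.hasBasis_tails hF) |>.2 fun K hK => ⟨K, hK,
    h.mono _ (h.diff_mem E hE K hK) _ (h.diff_mem F hF K hK) (sdiff_subset_sdiff_left hEF)⟩

theorem exists_tails_le_cofinite (hF : F ∈ ρ.dom) :
    ∃ E ∈ ρ.dom, E ⊆ F ∧ ρ.tails E ≤ cofinite := by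
  obtain ⟨E, hE, hEF, hsparse⟩ := h.sparse F hF
  refine ⟨E, hE, hEF, le_cofinite_iff_compl_singleton_mem.2 fun a => ?_⟩
  by_cases ha : a ∈ ρ.map E
  · obtain ⟨K, hK, haK⟩ := hsparse a ha
    exact (h.hasBasis_tails hE).mem_iff.2 ⟨K, hK, subset_compl_singleton_iff.2 haK⟩
  · exact mem_of_superset (h.map_mem_tails hE) (subset_compl_singleton_iff.2 ha)

end IsPartitionRegular

theorem katetovLE_iff {Ω₁ Λ₁ Ω₂ Λ₂ : Type*} {ρ₁ : FamilyMap Ω₁ Λ₁} {ρ₂ : FamilyMap Ω₂ Λ₂}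
    (h₁ : ρ₁.IsPartitionRegular) (h₂ : ρ₂.IsPartitionRegular) : KatetovLE ρ₂ ρ₁ ↔
      ∃ f : Λ₁ → Λ₂, ∀ F₁ ∈ ρ₁.dom, ∃ F₂ ∈ ρ₂.dom, ρ₂.tails F₂ ≤ Filter.map f (ρ₁.tails F₁) := by
  refine exists_congr fun f => forall₂_congr fun F₁ hF₁ => exists_congr fun F₂ =>
    and_congr_right fun hF₂ => ?_
  exact ((h₂.hasBasis_tails hF₂).le_basis_iff ((h₁.hasBasis_tails hF₁).map f)).symm

end Tails

section FinBW

theorem FinBW.of_katetovLE {Ω' Λ' : Type*} {ρ' : FamilyMap Ω' Λ'} (h : ρ.IsPartitionRegular)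
    (h' : ρ'.IsPartitionRegular) (hle : KatetovLE ρ' ρ) (hX : ρ.FinBW X) : ρ'.FinBW X := by
  obtain ⟨g, hg⟩ := (katetovLE_iff h h').1 hle
  intro f
  obtain ⟨F, hF, y, hy⟩ := hX (f ∘ g)
  obtain ⟨F', hF', hle'⟩ := hg F hF
  have hfg : Tendsto f (Filter.map g (ρ.tails F)) (𝓝 y) :=
    tendsto_map'_iff.2 ((h.convergesTo_iff_tendsto hF).1 hy)
  exact ⟨F', hF', y, (h'.convergesTo_iff_tendsto hF').2 (hfg.mono_left hle')⟩

theorem FinBW.of_surjective (h : ρ.IsPartitionRegular) (hX : ρ.FinBW X) {g : X → Y}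
    (hg : Continuous g) (hsurj : Function.Surjective g) : ρ.FinBW Y := by
  intro f
  obtain ⟨F, hF, y, hy⟩ := hX (Function.surjInv hsurj ∘ f)
  refine ⟨F, hF, g y, (h.convergesTo_iff_tendsto hF).2 ?_⟩
  have hlim := (hg.tendsto y).comp ((h.convergesTo_iff_tendsto hF).1 hy)
  rwa [← Function.comp_assoc, (Function.rightInverse_surjInv hsurj).comp_eq_id,
    Function.id_comp] at hlim

theorem FinBW.of_isClosedEmbedding (h : ρ.IsPartitionRegular) (hY : ρ.FinBW Y) {e : X → Y}
    (he : IsClosedEmbedding e) : ρ.FinBW X := by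
  intro f
  obtain ⟨F, hF, z, hz⟩ := hY (e ∘ f)
  rw [h.convergesTo_iff_tendsto hF] at hz
  have := h.tails_neBot hF
  obtain ⟨y, rfl⟩ := he.isClosed_range.mem_of_tendsto hz (.of_forall fun a => mem_range_self (f a))
  exact ⟨F, hF, y, (h.convergesTo_iff_tendsto hF).2 (he.tendsto_nhds_iff.2 hz)⟩

namespace IsPartitionRegular

variable (h : ρ.IsPartitionRegular)
include h

theorem seqCompactSpace_of_finBW [FirstCountableTopology X] (hX : ρ.FinBW X) :
    SeqCompactSpace X := by
  have := h.countable_target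
  have := h.infinite_target
  obtain ⟨e⟩ := nonempty_equiv_of_countable (α := Λ) (β := ℕ)
  refine ⟨fun u _ => ?_⟩
  obtain ⟨F, hF, y, hy⟩ := hX (u ∘ e)
  obtain ⟨E, hE, hEF, hcof⟩ := h.exists_tails_le_cofinite hF
  have := h.tails_neBot hE
  have hE_tendsto : Tendsto (u ∘ e) (ρ.tails E) (𝓝 y) :=
    ((h.convergesTo_iff_tendsto hF).1 hy).mono_left (h.tails_mono hE hF hEF)
  have he : Tendsto e (ρ.tails E) atTop :=
    Nat.cofinite_eq_atTop ▸ e.injective.tendsto_cofinite.mono_left hcof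
  exact ⟨y, mem_univ y, (hE_tendsto.mapClusterPt.of_comp he).tendsto_subseq⟩

theorem finBW_of_compactSpace (hI : ρ.FinBW unitInterval) (Y : Type*) [MetricSpace Y]
    [CompactSpace Y] : ρ.FinBW Y := by
  have := h.infinite_target
  rcases isEmpty_or_nonempty Y with _ | _
  · exact fun f => isEmptyElim (f (Classical.arbitrary Λ))
  obtain ⟨g, hg, hsurj⟩ := exists_nat_bool_continuous_surjective_of_compact Y
  have he : IsClosedEmbedding (Set.inclusion cantorSet_subset_unitInterval) :=
    IsClosedEmbedding.inclusion cantorSet_subset_unitInterval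
      (isClosed_cantorSet.preimage continuous_subtype_val)
  exact (hI.of_isClosedEmbedding h he).of_surjective h
    (hg.comp cantorSetHomeomorphNatToBool.continuous)
    (hsurj.comp cantorSetHomeomorphNatToBool.surjective)

end IsPartitionRegular

end FinBW

namespace IsPartitionRegular

variable (h : ρ.IsPartitionRegular)
include h

theorem exists_map_subset_of_subset_biUnion {ι : Type*} {I : Set ι} (hI : I.Finite)
    (S : ι → Set Λ) (hF : F ∈ ρ.dom) (hFS : ρ.map F ⊆ ⋃ i ∈ I, S i) :
    ∃ E ∈ ρ.dom, ∃ i ∈ I, ρ.map E ⊆ S i := by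
  induction I, hI using Set.Finite.induction_on generalizing F with
  | empty =>
    obtain ⟨a, ha⟩ := (h.map_infinite F hF).nonempty
    simpa using hFS ha
  | @insert i I _ _ ih =>
    rw [biUnion_insert] at hFS
    obtain ⟨E, hE, hEi | hEI⟩ := h.regular F hF (ρ.map F ∩ S i) (ρ.map F \ S i)
      (inter_union_sdiff _ _).symm
    · exact ⟨E, hE, i, mem_insert i I, hEi.trans inter_subset_right⟩
    · obtain ⟨E', hE', j, hj, hsub⟩ := ih hE (hEI.trans (sdiff_subset_iff.2 hFS))
      exact ⟨E', hE', j, mem_insert_of_mem i hj, hsub⟩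

theorem exists_convergesTo_of_finite_limitPoints [CompactSpace X] [T2Space X] {f : Λ → X}
    (hF : F ∈ ρ.dom) (hfin : (limitPoints f (ρ.map F)).Finite) :
    ∃ E ∈ ρ.dom, ∃ p, ρ.ConvergesTo f E p := by
  obtain ⟨T, hT, hrest⟩ := exists_tendsto_cover_of_finite_limitPoints hfin
  obtain ⟨E, hE, hEF, hcof⟩ := h.exists_tails_le_cofinite hF
  obtain ⟨K, hK, hKsub⟩ := (h.hasBasis_tails hE).mem_iff.1 (hcof hrest.compl_mem_cofinite)
  have hcover : ρ.map (E \ K) ⊆ ⋃ p ∈ limitPoints f (ρ.map F), T p := fun a ha =>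
    by_contra fun hna => hKsub ha
      ⟨h.mono _ (h.diff_mem E hE K hK) F hF (sdiff_subset.trans hEF) ha, hna⟩
  obtain ⟨E₁, hE₁, p, hp, hE₁T⟩ :=
    h.exists_map_subset_of_subset_biUnion hfin T (h.diff_mem E hE K hK) hcover
  obtain ⟨E₂, hE₂, hE₂₁, hcof₂⟩ := h.exists_tails_le_cofinite hE₁
  have hle : ρ.tails E₂ ≤ 𝓟 (T p) :=
    (h.tails_mono hE₂ hE₁ hE₂₁).trans <|
      le_principal_iff.2 (mem_of_superset (h.map_mem_tails hE₁) hE₁T)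
  exact ⟨E₂, hE₂, p, (h.convergesTo_iff_tendsto hE₂).2 ((hT p hp).mono_left (le_inf hcof₂ hle))⟩

theorem isSpread_tails [CompactSpace X] [T2Space X] {f : Λ → X}
    (hf : ∀ E ∈ ρ.dom, ∀ p, ¬ ρ.ConvergesTo f E p) (hF : F ∈ ρ.dom) :
    IsSpread f (ρ.tails F) where
  infinite_limitPoints s hs hfin := by
    obtain ⟨K, hK, hKs⟩ := (h.hasBasis_tails hF).mem_iff.1 hs
    obtain ⟨E, hE, p, hp⟩ := h.exists_convergesTo_of_finite_limitPoints (h.diff_mem F hF K hK)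
      (hfin.subset (limitPoints_mono hKs))
    exact hf E hE p hp
  not_tendsto p hp := hf F hF p ((h.convergesTo_iff_tendsto hF).2 hp)

theorem exists_injective_forall_not_convergesTo {D Y : Type*} [MetricSpace Y]
    [∀ q : Y, (𝓝[≠] q).NeBot] {u : D → Y} (hu : DenseRange u) (hY : ¬ ρ.FinBW Y) :
    ∃ g : Λ → D, Function.Injective g ∧ ∀ F ∈ ρ.dom, ∀ p, ¬ ρ.ConvergesTo (u ∘ g) F p := by
  have := h.countable_target
  obtain ⟨f, hf⟩ := not_forall.1 hY
  obtain ⟨g, hg, hdist⟩ := exists_injective_tendsto_dist_zero hu f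
  refine ⟨g, hg, fun F hF p hp => hf ?_⟩
  obtain ⟨E, hE, hEF, hcof⟩ := h.exists_tails_le_cofinite hF
  have hE_tendsto : Tendsto (u ∘ g) (ρ.tails E) (𝓝 p) :=
    ((h.convergesTo_iff_tendsto hF).1 hp).mono_left (h.tails_mono hE hF hEF)
  refine ⟨E, hE, p, (h.convergesTo_iff_tendsto hE).2 (hE_tendsto.congr_dist ?_)⟩
  simpa only [dist_comm, Function.comp_apply] using hdist.mono_left hcof

end IsPartitionRegular

end FamilyMap

section RhoUnit

variable {ι : Type*} {A : ι → Set ℕ} {x : ι → ℕ × ℕ → ratUnit}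

theorem rhoUnit_diff_mem_dom {F : Set ℕ} (hF : F ∈ (rhoUnit A x).dom) {K : Set ℕ}
    (hK : K.Finite) : F \ K ∈ (rhoUnit A x).dom := by
  obtain ⟨α, L, hL, rfl⟩ := hF
  exact ⟨α, L ∪ K, hL.union hK, sdiff_sdiff⟩

theorem monotoneOn_rhoUnit_map (hA : IsAlmostDisjointFamily A) :
    MonotoneOn (rhoUnit A x).map (rhoUnit A x).dom := by
  rintro _ ⟨α, K, hK, rfl⟩ _ ⟨β, L, hL, rfl⟩ hsub
  obtain rfl : α = β := by
    by_contra hne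
    exact (hA.1 α).sdiff hK ((hA.2 α β hne).subset fun m hm => ⟨hm.1, (hsub hm).1⟩)
  rw [rhoUnit_map_diff hA x α hK, rhoUnit_map_diff hA x α hL]
  exact image_mono fun z hz m hm => hz m ⟨hm.1, by_contra fun hmK => (hsub ⟨hm.1, hmK⟩).2 hm.2⟩

theorem hasBasis_tails_rhoUnit (hA : IsAlmostDisjointFamily A) {F : Set ℕ}
    (hF : F ∈ (rhoUnit A x).dom) :
    ((rhoUnit A x).tails F).HasBasis Set.Finite fun K => (rhoUnit A x).map (F \ K) :=
  FamilyMap.hasBasis_tails (fun _ hK => rhoUnit_diff_mem_dom hF hK) (monotoneOn_rhoUnit_map hA)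

theorem tails_rhoUnit (hA : IsAlmostDisjointFamily A) (α : ι) {L : Set ℕ} (hL : L.Finite) :
    (rhoUnit A x).tails (A α \ L) = map (x α) rowTails := by
  refine (hasBasis_tails_rhoUnit hA ⟨α, L, hL, rfl⟩).ext (hasBasis_rowTails.map (x α))
    (fun K hK => ?_) (fun n _ => ?_)
  · obtain ⟨n, hn⟩ := (hL.union hK).bddAbove
    refine ⟨n, trivial, ?_⟩
    rw [sdiff_sdiff, rhoUnit_map_diff hA x α (hL.union hK)]
    exact image_mono fun z hz m hm => (hn hm.2).trans_lt hz
  · obtain ⟨m, hm, hnm⟩ := (hA.1 α).exists_gt n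
    refine ⟨{m}, finite_singleton m, ?_⟩
    rw [sdiff_sdiff, rhoUnit_map_diff hA x α (hL.union (finite_singleton m))]
    exact image_mono fun z hz => hnm.trans (hz m ⟨hm, Or.inr rfl⟩)

theorem isSpread_tails_rhoUnit (hA : IsAlmostDisjointFamily A) (hx : range x = spreadInjections)
    {F : Set ℕ} (hF : F ∈ (rhoUnit A x).dom) :
    IsSpread ((↑) : ratUnit → unitInterval) ((rhoUnit A x).tails F) := by
  obtain ⟨α, L, hL, rfl⟩ := hF
  obtain ⟨hinj, hspread⟩ := mem_spreadInjections_iff.1 (hx ▸ mem_range_self α)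
  rw [tails_rhoUnit hA α hL]
  exact IsSpread.map hinj hspread

theorem tails_rhoUnit_le_cofinite (hA : IsAlmostDisjointFamily A)
    (hx : range x = spreadInjections) {F : Set ℕ} (hF : F ∈ (rhoUnit A x).dom) :
    (rhoUnit A x).tails F ≤ cofinite := by
  obtain ⟨α, L, hL, rfl⟩ := hF
  obtain ⟨hinj, -⟩ := mem_spreadInjections_iff.1 (hx ▸ mem_range_self α)
  rw [tails_rhoUnit hA α hL]
  exact (map_mono rowTails_le_cofinite).trans hinj.tendsto_cofinite

theorem exists_tails_rhoUnit_le (hA : IsAlmostDisjointFamily A) (hx : range x = spreadInjections)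
    {l : Filter ratUnit} [l.IsCountablyGenerated] (hl : l ≤ cofinite)
    (h : IsSpread ((↑) : ratUnit → unitInterval) l) :
    ∃ F ∈ (rhoUnit A x).dom, (rhoUnit A x).tails F ≤ l := by
  obtain ⟨y, hy, hyl, hspread⟩ := h.exists_injective_map_rowTails_le hl
  obtain ⟨α, rfl⟩ : y ∈ range x := hx ▸ mem_spreadInjections_iff.2 ⟨hy, hspread⟩
  refine ⟨A α \ ∅, ⟨α, ∅, finite_empty, rfl⟩, ?_⟩
  rwa [tails_rhoUnit hA α finite_empty]

theorem not_memConv_rhoUnit_map (hA : IsAlmostDisjointFamily A)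
    (hx : range x = spreadInjections) {F : Set ℕ} (hF : F ∈ (rhoUnit A x).dom) :
    ¬ MemConv ((rhoUnit A x).map F) := by
  have hmem : (rhoUnit A x).map F ∈ (rhoUnit A x).tails F := by
    simpa only [sdiff_empty] using (hasBasis_tails_rhoUnit hA hF).mem_of_mem finite_empty
  exact memConv_iff.not.2 ((isSpread_tails_rhoUnit hA hx hF).infinite_limitPoints _ hmem)

theorem exists_rhoUnit_map_subset (hA : IsAlmostDisjointFamily A)
    (hx : range x = spreadInjections) {D : Set ratUnit} (hD : ¬ MemConv D) :
    ∃ E ∈ (rhoUnit A x).dom, (rhoUnit A x).map E ⊆ D := by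
  have := countable_ratUnit
  have := cofinite_isCountablyGenerated (Λ := ratUnit)
  obtain ⟨F, hF, hle⟩ := exists_tails_rhoUnit_le hA hx (inf_le_left (b := 𝓟 D))
    (isSpread_cofinite_inf_principal (memConv_iff.not.1 hD))
  obtain ⟨K, hK, hKD⟩ :=
    (hasBasis_tails_rhoUnit hA hF).mem_iff.1 (hle (mem_inf_of_right (mem_principal_self D)))
  exact ⟨F \ K, rhoUnit_diff_mem_dom hF hK, hKD⟩

theorem rhoUnit_isPartitionRegular (hA : IsAlmostDisjointFamily A)
    (hx : range x = spreadInjections) : (rhoUnit A x).IsPartitionRegular where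
  countable_source := inferInstance
  infinite_source := inferInstance
  countable_target := countable_ratUnit
  infinite_target := infinite_univ_iff.1 fun hfin => not_memConv_univ (memConv_of_finite hfin)
  dom_nonempty :=
    let ⟨E, hE, _⟩ := exists_rhoUnit_map_subset hA hx not_memConv_univ
    ⟨E, hE⟩
  infinite_of_mem := by
    rintro _ ⟨α, K, hK, rfl⟩
    exact (hA.1 α).sdiff hK
  diff_mem _ hF _ hK := rhoUnit_diff_mem_dom hF hK
  map_infinite _ hF hfin := not_memConv_rhoUnit_map hA hx hF (memConv_of_finite hfin)
  mono _ hE _ hF hEF := monotoneOn_rhoUnit_map hA hE hF hEF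
  regular F hF B C hBC := by
    have hnot : ¬ MemConv B ∨ ¬ MemConv C := not_and_or.1 fun ⟨hB, hC⟩ =>
      not_memConv_rhoUnit_map hA hx hF (hBC ▸ hB.union hC)
    rcases hnot with hB | hC
    · obtain ⟨E, hE, hEB⟩ := exists_rhoUnit_map_subset hA hx hB
      exact ⟨E, hE, Or.inl hEB⟩
    · obtain ⟨E, hE, hEC⟩ := exists_rhoUnit_map_subset hA hx hC
      exact ⟨E, hE, Or.inr hEC⟩
  sparse E hE := by
    refine ⟨E, hE, Subset.rfl, fun a _ => ?_⟩
    obtain ⟨K, hK, haK⟩ := (hasBasis_tails_rhoUnit hA hE).mem_iff.1 <|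
      tails_rhoUnit_le_cofinite hA hx hE (finite_singleton a).compl_mem_cofinite
    exact ⟨K, hK, subset_compl_singleton_iff.1 haK⟩

theorem not_finBW_rhoUnit (hA : IsAlmostDisjointFamily A) (hx : range x = spreadInjections) :
    ¬ (rhoUnit A x).FinBW unitInterval := by
  intro hI
  obtain ⟨F, hF, p, hp⟩ := hI (↑)
  exact (isSpread_tails_rhoUnit hA hx hF).not_tendsto p
    (((rhoUnit_isPartitionRegular hA hx).convergesTo_iff_tendsto hF).1 hp)

theorem katetovLE_rhoUnit_of_not_finBW (hA : IsAlmostDisjointFamily A)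
    (hx : range x = spreadInjections) {Ω Λ : Type*} {ρ : FamilyMap Ω Λ}
    (h : ρ.IsPartitionRegular) (hI : ¬ ρ.FinBW unitInterval) :
    FamilyMap.KatetovLE (rhoUnit A x) ρ := by
  obtain ⟨g, hg, hconv⟩ :=
    h.exists_injective_forall_not_convergesTo dense_ratUnit.denseRange_val hI
  refine (FamilyMap.katetovLE_iff h (rhoUnit_isPartitionRegular hA hx)).2 ⟨g, fun F hF => ?_⟩
  obtain ⟨E, hE, hEF, hcof⟩ := h.exists_tails_le_cofinite hF
  have := h.tails_isCountablyGenerated hE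
  obtain ⟨F', hF', hle⟩ := exists_tails_rhoUnit_le hA hx
    ((map_mono hcof).trans hg.tendsto_cofinite) (IsSpread.map hg (h.isSpread_tails hconv hE))
  exact ⟨F', hF', hle.trans (map_mono (h.tails_mono hE hF hEF))⟩

theorem katetovLE_rhoUnit_iff_not_finBW (hA : IsAlmostDisjointFamily A)
    (hx : range x = spreadInjections) {Ω Λ : Type*} {ρ : FamilyMap Ω Λ}
    (h : ρ.IsPartitionRegular) :
    FamilyMap.KatetovLE (rhoUnit A x) ρ ↔ ¬ ρ.FinBW unitInterval :=
  ⟨fun hle hI =>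
      not_finBW_rhoUnit hA hx (hI.of_katetovLE h (rhoUnit_isPartitionRegular hA hx) hle),
    katetovLE_rhoUnit_of_not_finBW hA hx h⟩

end RhoUnit

theorem mainTheorem4 {ι : Type*} (A : ι → Set ℕ) (hA : IsAlmostDisjointFamily A)
    (x : ι → ℕ × ℕ → ratUnit) (hx : Set.range x = spreadInjections) :
    (rhoUnit A x).IsPartitionRegular ∧
    ∀ {Ω Λ : Type*} (ρ : FamilyMap Ω Λ), ρ.IsPartitionRegular →
      List.TFAE [
        ∀ (Y : Type*) [MetricSpace Y], ρ.FinBW Y ↔ CompactSpace Y,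
        ρ.FinBW unitInterval,
        ¬ FamilyMap.KatetovLE (rhoUnit A x) ρ] := by
  refine ⟨rhoUnit_isPartitionRegular hA hx, fun ρ h => ?_⟩
  tfae_have 1 → 2 := fun H =>
    ((H (ULift unitInterval)).2 inferInstance).of_surjective h continuous_uliftDown
      ULift.down_surjective
  tfae_have 2 → 1 := fun hI Y _ =>
    ⟨fun hY => compactSpace_iff_seqCompactSpace.2 (h.seqCompactSpace_of_finBW hY),
      fun _ => h.finBW_of_compactSpace hI Y⟩
  tfae_have 2 ↔ 3 := (katetovLE_rhoUnit_iff_not_finBW hA hx h).not_left.symm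
  tfae_finish
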